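/- Let $n\ge 0$ and let $Cl_n$ be the real Clifford algebra generated by $e_1,\dots,e_n$ with $e_ie_j+e_je_i=-2\delta_{ij}$, let $e_0=1$, and give $Cl_n$ the Euclidean norm $|\sum_A a_Ae_A|=(\sum_A a_A^2)^{1/2}$ with respect to the standard basis $(e_A)$. For a linear function $\Gamma:\mathbb R^{n+1}\to\mathbb R$ put $\gamma_j=\partial\Gamma/\partial x_j$ and $$D_\gamma f=\sum_{j=0}^{n}e_j\Big(\frac{\partial f}{\partial x_j}-\gamma_j f\Big)$$ for $Cl_n$-valued functions $f$. Let $\mu$ be Lebesgue measure on $\mathbb R^{n+1}$. For a compact set $\Omega\subset\mathbb R^{n+1}$ let $C(\Omega,Cl_n)$ carry the supremum norm $\|\cdot\|_\infty$, and let $M_\gamma(\Omega,Cl_n)$ be the set of functions in $C(\Omega,Cl_n)$ that are $C^1$ in the interior of $\Omega$ and satisfy $D_\gamma\varphi=0$ there. For all $n\ge0$ and $K\in\mathbb R$ there is a constant $\beta>0$, depending only on $n$ and $K$, such that the following holds. Let $\Omega\subset\mathbb R^{n+1}$ be compact (for example a compact domain), let $\Gamma$ be linear with $\Gamma(x)-\Gamma(y)\le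 K$ for all $x,y\in\Omega$ (for given $\Gamma$ and $\Omega$ there is always such a $K$; for $\Gamma=0$ one may take $K=0$), let $g$ be a $Cl_n$-valued $C^\infty$ function on $\Omega$ and $h$ a $Cl_n$-valued $C^\infty$ function on $\partial\Omega$. (i) If $f$ is a solution of $$D_\gamma f=g\ \text{ on }\Omega,\qquad \operatorname{tr}f=h\ \text{ on }\partial\Omega,$$ in the sense that $f$ is continuous on $\Omega$ and $C^1$ in the interior of $\Omega$, $D_\gamma f=g$ in the interior, and $f=h$ on $\partial\Omega$, then $$\operatorname{dist}_{C(\Omega,Cl_n)}\big(f,M_\gamma(\Omega,Cl_n)\big)\le\beta\,\mu(\Omega)^{\frac1{n+1}}\,\|g\|_\infty .$$ (ii) If moreover the solution is $C^1$ up to the boundary, in the sense that $f$ is $C^1$ on an open neighbourhood of $\Omega$, $D_\gamma f=g$ at every point of $\Omega$, and $f=h$ on $\partial\Omega$, then the same inequality holds with $M_\gamma(\Omega,Cl_n)$ replaced by its subset of functions that extend to $C^1$ functions with $D_\gamma\varphi=0$ on an open neighbourhood of $\Omega$. -/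

import Mathlib

open scoped ContDiff

noncomputable section

namespace CliffordAnalysis

/-! ### The Clifford algebra `Cl_n`, its basis `e_A` and its Euclidean norm -/

/-- The negative definite form `x ↦ -‖x‖²` on `ℝⁿ`. -/
def negSq (n : ℕ) : QuadraticForm ℝ (Fin n → ℝ) :=
  QuadraticMap.weightedSumSquares ℝ (fun _ : Fin n => (-1 : ℝ))

/-- The real Clifford algebra `Cl_n`, generated by `ℝⁿ` with `x² = -‖x‖²`. -/
abbrev Cl (n : ℕ) : Type := CliffordAlgebra (negSq n)

/-- The generators `e_1, …, e_n` of `Cl_n` (indexed from `0`). -/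
def gen {n : ℕ} (i : Fin n) : Cl n := CliffordAlgebra.ι (negSq n) (Pi.single i 1)

/-- `e_0 = 1, e_1, …, e_n`. -/
def e {n : ℕ} (j : Fin (n + 1)) : Cl n :=
  Fin.cases (motive := fun _ => Cl n) 1 gen j

/-- The product `e_A = e_{i_1} ⋯ e_{i_k}` for `A = {i_1 < ⋯ < i_k}`. -/
def eProd {n : ℕ} (A : Finset (Fin n)) : Cl n := ((A.sort (· ≤ ·)).map gen).prod

theorem negSq_apply (n : ℕ) (v : Fin n → ℝ) : negSq n v = -∑ i, v i * v i := by
  simp [negSq, QuadraticMap.weightedSumSquares_apply]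

theorem gen_mul_self {n : ℕ} (i : Fin n) : gen i * gen i = -(1 : Cl n) := by
  rw [gen, CliffordAlgebra.ι_sq_scalar, negSq_apply]
  simp [Pi.single_apply]

theorem gen_mul_gen {n : ℕ} {i j : Fin n} (h : i ≠ j) :
    gen i * gen j = -(gen j * gen i : Cl n) := by
  have key : gen i * gen j + gen j * gen i = (0 : Cl n) := by
    rw [gen, gen]
    apply CliffordAlgebra.ι_mul_ι_add_swap_of_isOrtho
    rw [QuadraticMap.isOrtho_def]
    simp only [negSq_apply, Pi.add_apply, Pi.single_apply, ← neg_add, ← Finset.sum_add_distrib]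
    congr 1
    refine Finset.sum_congr rfl fun k _ => ?_
    by_cases h1 : k = i
    · subst h1; simp [h]
    · simp [h1]
  exact eq_neg_of_add_eq_zero_left key

theorem eProd_empty (n : ℕ) : eProd (∅ : Finset (Fin n)) = 1 := by simp [eProd]

theorem eProd_insert {n : ℕ} {a : Fin n} {A : Finset (Fin n)} (h : ∀ b ∈ A, a < b) :
    eProd (insert a A) = gen a * eProd A := by
  have ha : a ∉ A := fun ha => lt_irrefl _ (h a ha)
  rw [eProd, Finset.sort_insert _ (fun b hb => (h b hb).le) ha]
  simp [eProd]

theorem gen_mul_eProd {n : ℕ} (A : Finset (Fin n)) (i : Fin n) :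
    ∃ s : ℝ, gen i * eProd A = s • eProd (if i ∈ A then A.erase i else insert i A) := by
  induction A using Finset.induction_on_min generalizing i with
  | empty =>
    refine ⟨1, ?_⟩
    rw [if_neg (Finset.notMem_empty i), eProd_insert (by simp), one_smul]
  | insert a A ha ih =>
    have haA : a ∉ A := fun h => lt_irrefl _ (ha a h)
    rcases lt_trichotomy i a with h | h | h
    · have hlt : ∀ b ∈ insert a A, i < b := by
        intro b hb
        rcases Finset.mem_insert.1 hb with rfl | hb
        · exact h
        · exact h.trans (ha b hb)
      have hi : i ∉ insert a A := fun hi => lt_irrefl _ (hlt i hi)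
      exact ⟨1, by rw [if_neg hi, eProd_insert hlt, one_smul]⟩
    · subst h
      refine ⟨-1, ?_⟩
      rw [eProd_insert ha, ← mul_assoc, gen_mul_self, if_pos (Finset.mem_insert_self _ _),
        Finset.erase_insert haA]
      simp
    · obtain ⟨s, hs⟩ := ih i
      refine ⟨-s, ?_⟩
      have hB : ∀ b ∈ (if i ∈ A then A.erase i else insert i A), a < b := by
        intro b hb
        split_ifs at hb with hi
        · exact ha b (Finset.mem_of_mem_erase hb)
        · rcases Finset.mem_insert.1 hb with rfl | hb
          · exact h
          · exact ha b hb
      have hset : (if i ∈ insert a A then (insert a A).erase i else insert i (insert a A))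
          = insert a (if i ∈ A then A.erase i else insert i A) := by
        by_cases hi : i ∈ A
        · simp [hi, Finset.erase_insert_of_ne h.ne]
        · simp [hi, h.ne', Finset.insert_comm]
      rw [hset, eProd_insert hB, eProd_insert ha, ← mul_assoc, gen_mul_gen h.ne', neg_mul,
        mul_assoc, hs]
      simp

theorem span_eProd (n : ℕ) :
    ⊤ ≤ Submodule.span ℝ (Set.range (eProd : Finset (Fin n) → Cl n)) := by
  have hmul : ∀ (i : Fin n) (x : Cl n), x ∈ Submodule.span ℝ (Set.range (eProd (n := n))) →
      gen i * x ∈ Submodule.span ℝ (Set.range (eProd (n := n))) := by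
    intro i x hx
    induction hx using Submodule.span_induction with
    | mem x hx =>
      obtain ⟨A, rfl⟩ := hx
      obtain ⟨s, hs⟩ := gen_mul_eProd A i
      rw [hs]
      exact Submodule.smul_mem _ _ (Submodule.subset_span ⟨_, rfl⟩)
    | zero => simp
    | add x y _ _ hx hy => rw [mul_add]; exact Submodule.add_mem _ hx hy
    | smul r x _ hx => rw [mul_smul_comm]; exact Submodule.smul_mem _ _ hx
  intro x _
  induction x using CliffordAlgebra.left_induction with
  | algebraMap r =>
    rw [Algebra.algebraMap_eq_smul_one, ← eProd_empty]
    exact Submodule.smul_mem _ _ (Submodule.subset_span ⟨_, rfl⟩)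
  | add x y hx hy => exact Submodule.add_mem _ (hx trivial) (hy trivial)
  | ι_mul x m hx =>
    have hm : CliffordAlgebra.ι (negSq n) m = ∑ i, m i • (gen i : Cl n) := by
      conv_lhs => rw [pi_eq_sum_univ' m]
      simp only [map_sum, map_smul, gen]
    rw [hm, Finset.sum_mul]
    refine Submodule.sum_mem _ fun i _ => ?_
    rw [smul_mul_assoc]
    exact Submodule.smul_mem _ _ (hmul i x (hx trivial))

theorem card_eq_finrank (n : ℕ) :
    Fintype.card (Finset (Fin n)) = Module.finrank ℝ (Cl n) := by
  rw [(CliffordAlgebra.equivExterior (negSq n)).finrank_eq,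
    Module.finrank_eq_card_basis (Pi.basisFun ℝ (Fin n)).ExteriorAlgebra]

/-- The standard basis `(e_A)_A` of `Cl_n`. -/
def eBasis (n : ℕ) : Module.Basis (Finset (Fin n)) ℝ (Cl n) :=
  basisOfTopLeSpanOfCardEqFinrank eProd (span_eProd n) (card_eq_finrank n)

theorem eBasis_apply {n : ℕ} (A : Finset (Fin n)) : eBasis n A = eProd A := by
  simp [eBasis]

/-- The coefficient vector `(a_A)_A` of `a = ∑_A a_A e_A`, in Euclidean space. -/
def coeff (n : ℕ) : Cl n →ₗ[ℝ] EuclideanSpace ℝ (Finset (Fin n)) :=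
  ((eBasis n).equivFun.trans
    (WithLp.linearEquiv 2 ℝ (Finset (Fin n) → ℝ)).symm).toLinearMap

theorem coeff_injective (n : ℕ) : Function.Injective (coeff n) :=
  LinearEquiv.injective _

theorem coeff_apply {n : ℕ} (a : Cl n) (A : Finset (Fin n)) :
    coeff n a A = (eBasis n).repr a A := rfl

/-- `Cl_n` with the Euclidean norm `|a| = (∑_A a_A²)^{1/2}`. -/
instance instNormedAddCommGroupCl (n : ℕ) : NormedAddCommGroup (Cl n) :=
  NormedAddCommGroup.induced (Cl n) (EuclideanSpace ℝ (Finset (Fin n))) (coeff n)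
    (coeff_injective n)

instance instNormedSpaceCl (n : ℕ) : NormedSpace ℝ (Cl n) :=
  NormedSpace.induced ℝ (Cl n) (EuclideanSpace ℝ (Finset (Fin n))) (coeff n)

theorem norm_def {n : ℕ} (a : Cl n) : ‖a‖ = √(∑ A, ((eBasis n).repr a A) ^ 2) := by
  change ‖coeff n a‖ = _
  simp [EuclideanSpace.norm_eq, coeff_apply]

/-! ### The inhomogeneous Dirac operator and `γ`-regular functions -/

/-- `ℝ^{n+1}` with coordinates `x_0, …, x_n`. -/
abbrev Space (n : ℕ) : Type := EuclideanSpace ℝ (Fin (n + 1))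

/-- The partial derivative `∂f/∂x_j` at `x`. -/
def pd {n : ℕ} {F : Type*} [NormedAddCommGroup F] [NormedSpace ℝ F]
    (j : Fin (n + 1)) (f : Space n → F) (x : Space n) : F :=
  fderiv ℝ f x (EuclideanSpace.single j 1)

/-- `D_γ f = ∑_{j=0}^n e_j (∂f/∂x_j - γ_j f)`, where `γ_j = ∂Γ/∂x_j`. -/
def diracGamma {n : ℕ} (Γ : Space n → ℝ) (f : Space n → Cl n) (x : Space n) : Cl n :=
  ∑ j, e j * (pd j f x - pd j Γ x • f x)

/-- `f` is (left) `γ`-regular on the open set `U`: it is `C¹` there and `D_γ f = 0`. -/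
def IsGammaRegularOn {n : ℕ} (Γ : Space n → ℝ) (f : Space n → Cl n) (U : Set (Space n)) : Prop :=
  ContDiffOn ℝ 1 f U ∧ ∀ x ∈ U, diracGamma Γ f x = 0

/-- The element of `C(Ω, Cl_n)` given by a function that is continuous on the compact set `Ω`. -/
def toC {n : ℕ} (Ω : TopologicalSpace.Compacts (Space n)) (f : Space n → Cl n)
    (hf : ContinuousOn f Ω) : C(Ω, Cl n) :=
  ⟨(Ω : Set (Space n)).domRestrict f, hf.domRestrict⟩

/-- `M_γ(Ω, Cl_n)`: the functions in `C(Ω, Cl_n)` that are `γ`-regular in the interior of `Ω`. -/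
def gammaRegular {n : ℕ} (Γ : Space n → ℝ) (Ω : TopologicalSpace.Compacts (Space n)) :
    Set C(Ω, Cl n) :=
  {φ | ∃ F : Space n → Cl n, (∀ x : Ω, F x = φ x) ∧
    IsGammaRegularOn Γ F (interior (Ω : Set (Space n)))}

/-- The functions in `C(Ω, Cl_n)` that are `γ`-regular on an open neighbourhood of `Ω`. -/
def gammaRegularNear {n : ℕ} (Γ : Space n → ℝ) (Ω : TopologicalSpace.Compacts (Space n)) :
    Set C(Ω, Cl n) :=
  {φ | ∃ (F : Space n → Cl n) (U : Set (Space n)), (∀ x : Ω, F x = φ x) ∧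
    IsOpen U ∧ (Ω : Set (Space n)) ⊆ U ∧ IsGammaRegularOn Γ F U}

/-! ### Solutions of the boundary value problem `D_γ f = g` on `Ω`, `tr f = h` on `∂Ω` -/

/-- Classical solutions: continuous on `Ω`, `C¹` in the interior, where `D_γ f = g`, and with
boundary values `h`. -/
structure IsSolution {n : ℕ} (Γ : Space n → ℝ) (Ω : TopologicalSpace.Compacts (Space n))
    (g h f : Space n → Cl n) : Prop where
  continuousOn : ContinuousOn f Ω
  contDiffOn : ContDiffOn ℝ 1 f (interior (Ω : Set (Space n)))
  dirac_eq : ∀ x ∈ interior (Ω : Set (Space n)), diracGamma Γ f x = g x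
  trace_eq : ∀ x ∈ frontier (Ω : Set (Space n)), f x = h x

/-- Solutions that are `C¹` up to the boundary: `C¹` on an open neighbourhood of `Ω`, with
`D_γ f = g` at every point of `Ω`, and with boundary values `h`. -/
structure IsSolutionUpToBoundary {n : ℕ} (Γ : Space n → ℝ)
    (Ω : TopologicalSpace.Compacts (Space n)) (g h f : Space n → Cl n) : Prop where
  contDiffOn : ∃ U : Set (Space n), IsOpen U ∧ (Ω : Set (Space n)) ⊆ U ∧ ContDiffOn ℝ 1 f U
  dirac_eq : ∀ x ∈ (Ω : Set (Space n)), diracGamma Γ f x = g x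
  trace_eq : ∀ x ∈ frontier (Ω : Set (Space n)), f x = h x

theorem IsSolutionUpToBoundary.continuousOn {n : ℕ} {Γ : Space n → ℝ}
    {Ω : TopologicalSpace.Compacts (Space n)} {g h f : Space n → Cl n}
    (hf : IsSolutionUpToBoundary Γ Ω g h f) : ContinuousOn f Ω := by
  obtain ⟨U, _, hU, hfU⟩ := hf.contDiffOn
  exact hfU.continuousOn.mono hU

end CliffordAnalysis

end

open CliffordAnalysis MeasureTheory

namespace CliffordAnalysis

open Filter Topology

/-! ### Multiplication in `Cl_n` and Clifford conjugation of vectors -/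

/-! Conjugation by `exp Γ` removes the lower-order term: `D_γ f = e^Γ D(e^{-Γ} f)`
(`diracGamma_eq`), with `D = ∑ e_j ∂_j`. So `f` is `γ`-regular exactly when `u = e^{-Γ} f` is
monogenic.

On a bounded open set `V`, extend `Du` by zero and let `T` be convolution with the normalised Cauchy
kernel. Then `u - T(Du)` is monogenic in `V` (`sub_potential_dirac_monogenic`), hence `f - P` is
`γ`-regular for `P = e^Γ T(Du)`. The kernel has size `|x - y|⁻ⁿ`, so `|P(x)|` is at most a constant
times `∫_V |x - y|⁻ⁿ e^{Γ(x)-Γ(y)} |D_γ f(y)| dy`. The exponential is bounded by `e^K`, and the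
integral of `|x - y|⁻ⁿ` over `V` by a multiple of `μ(V)^{1/(n+1)}`
(`exists_setIntegral_norm_pow_inv_le`). Only `Du` enters the transform, so the behaviour of `f` at
the boundary of `V` plays no role.

For (i), `V` is the interior of `Ω`. For (ii), `V` is a neighbourhood of `Ω` on which volume, `|D_γ
f|` and the oscillation of `Γ` are barely larger than on `Ω`; the excess in the first two then tends
to zero.

That `T` inverts `D` on compactly supported `C¹` functions (`potential_dirac`) comes from a smooth
regularisation of the kernel whose Dirac derivative is an approximate identity. -/

instance instFiniteDimensionalCl (n : ℕ) : FiniteDimensional ℝ (Cl n) :=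
  (eBasis n).finiteDimensional_of_finite

instance instCompleteSpaceCl (n : ℕ) : CompleteSpace (Cl n) := FiniteDimensional.complete ℝ _

/-- Multiplication of `Cl_n` as a continuous bilinear map. -/
noncomputable def mulL (n : ℕ) : Cl n →L[ℝ] Cl n →L[ℝ] Cl n :=
  (LinearMap.mul ℝ (Cl n)).toContinuousBilinearMap

/-- The Euclidean norm is not submultiplicative for large `n`; the factor `‖mulL n‖` ends up in `β`.
-/
theorem norm_mul_le_mulL {n : ℕ} (a b : Cl n) : ‖a * b‖ ≤ ‖mulL n‖ * ‖a‖ * ‖b‖ :=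
  (mulL n).le_opNorm₂ a b

theorem continuous_mulCl {n : ℕ} {X : Type*} [TopologicalSpace X] {f g : X → Cl n}
    (hf : Continuous f) (hg : Continuous g) : Continuous fun x => f x * g x :=
  ((mulL n).continuous.comp hf).clm_apply hg

/-- The embedding `x ↦ ∑ x_j e_j` of `ℝ^{n+1}` into `Cl_n`. -/
noncomputable def vec (n : ℕ) : Space n →L[ℝ] Cl n :=
  ∑ j, (EuclideanSpace.proj j : Space n →L[ℝ] ℝ).smulRight (e j)

/-- The conjugate `x ↦ x_0 - ∑_{j ≥ 1} x_j e_j` of a vector. -/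
noncomputable def conjVec (n : ℕ) : Space n →L[ℝ] Cl n :=
  (2 : ℝ) • (EuclideanSpace.proj 0 : Space n →L[ℝ] ℝ).smulRight (1 : Cl n) - vec n

theorem e_zero {n : ℕ} : (e 0 : Cl n) = 1 := rfl

theorem e_succ {n : ℕ} (i : Fin n) : (e i.succ : Cl n) = gen i := rfl

theorem vec_apply {n : ℕ} (x : Space n) : vec n x = ∑ j, x j • e j := by
  simp [vec]

theorem vec_single {n : ℕ} (j : Fin (n + 1)) : vec n (EuclideanSpace.single j 1) = e j := by
  simp [vec_apply]

theorem vec_eq {n : ℕ} (x : Space n) :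
    vec n x = algebraMap ℝ (Cl n) (x 0) + CliffordAlgebra.ι (negSq n) (fun i => x i.succ) := by
  rw [vec_apply, Fin.sum_univ_succ, e_zero, Algebra.algebraMap_eq_smul_one]
  congr 1
  conv_rhs => rw [pi_eq_sum_univ' (fun i : Fin n => x i.succ)]
  simp only [map_sum, map_smul, e_succ, gen]

theorem conjVec_eq {n : ℕ} (x : Space n) :
    conjVec n x = algebraMap ℝ (Cl n) (x 0) - CliffordAlgebra.ι (negSq n) (fun i => x i.succ) := by
  simp only [conjVec, sub_apply, vec_eq, Algebra.algebraMap_eq_smul_one,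
    smul_apply, ContinuousLinearMap.smulRight_apply, PiLp.proj_apply]
  module

theorem norm_sq_eq_zero_add {n : ℕ} (x : Space n) :
    ‖x‖ ^ 2 = x 0 * x 0 - negSq n (fun i => x i.succ) := by
  rw [EuclideanSpace.norm_sq_eq, Fin.sum_univ_succ, negSq_apply]
  simp [pow_two]

/-- The real part is central, so the cross terms cancel and only `x_0²` minus the square of the
vector part remains. -/
theorem conjVec_mul_vec {n : ℕ} (x : Space n) : conjVec n x * vec n x = ‖x‖ ^ 2 • (1 : Cl n) := by
  rw [vec_eq, conjVec_eq, norm_sq_eq_zero_add, sub_smul, ← Algebra.algebraMap_eq_smul_one,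
    ← Algebra.algebraMap_eq_smul_one, ← CliffordAlgebra.ι_sq_scalar, map_mul,
    sub_mul, mul_add, mul_add, Algebra.commutes (x 0) (CliffordAlgebra.ι (negSq n) _)]
  abel

theorem vec_mul_conjVec {n : ℕ} (x : Space n) : vec n x * conjVec n x = ‖x‖ ^ 2 • (1 : Cl n) := by
  rw [vec_eq, conjVec_eq, norm_sq_eq_zero_add, sub_smul, ← Algebra.algebraMap_eq_smul_one,
    ← Algebra.algebraMap_eq_smul_one, ← CliffordAlgebra.ι_sq_scalar, map_mul,
    add_mul, mul_sub, mul_sub, Algebra.commutes (x 0) (CliffordAlgebra.ι (negSq n) _)]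
  abel

theorem conjVec_single_mul_e {n : ℕ} (j : Fin (n + 1)) :
    conjVec n (EuclideanSpace.single j 1) * e j = 1 := by
  rw [← vec_single, conjVec_mul_vec]; simp

theorem e_mul_conjVec_single {n : ℕ} (j : Fin (n + 1)) :
    e j * conjVec n (EuclideanSpace.single j 1) = 1 := by
  rw [← vec_single, vec_mul_conjVec]; simp

/-! ### The regularised Cauchy kernel -/

/-- The Cauchy kernel `conj y / (|y|² + s)^{(n+1)/2}`, up to a constant factor; it is singular
at the origin for `s = 0` and smooth for `s > 0`. -/
noncomputable def kern (n : ℕ) (s : ℝ) (y : Space n) : Cl n :=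
  (‖y‖ ^ 2 + s) ^ (-((n : ℝ) + 1) / 2) • conjVec n y

/-- The derivative of the regularised Cauchy kernel. -/
noncomputable def kernDeriv (n : ℕ) (s : ℝ) (y : Space n) : Space n →L[ℝ] Cl n :=
  (‖y‖ ^ 2 + s) ^ (-((n : ℝ) + 1) / 2) • conjVec n -
    (((n : ℝ) + 1) * (‖y‖ ^ 2 + s) ^ (-((n : ℝ) + 3) / 2)) • (innerSL ℝ y).smulRight (conjVec n y)

theorem hasFDerivAt_kern {n : ℕ} {s : ℝ} {y : Space n} (h : ‖y‖ ^ 2 + s ≠ 0) :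
    HasFDerivAt (kern n s) (kernDeriv n s y) y := by
  have h1 : HasFDerivAt (fun y : Space n => ‖y‖ ^ 2 + s)
      (2 • (innerSL ℝ y) ∘SL ContinuousLinearMap.id ℝ _) y :=
    ((hasFDerivAt_id y).norm_sq).add_const s
  have h2 := (h1.rpow_const (p := -((n : ℝ) + 1) / 2) (Or.inl h)).smul
    (conjVec n).hasFDerivAt
  refine h2.congr_fderiv ?_
  ext v
  have : (-((n : ℝ) + 1) / 2 - 1) = -((n : ℝ) + 3) / 2 := by ring
  simp only [kernDeriv, this, add_apply, sub_apply,
    smul_apply, ContinuousLinearMap.smulRight_apply,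
    ContinuousLinearMap.comp_apply, ContinuousLinearMap.id_apply, smul_eq_mul, nsmul_eq_mul]
  module

theorem contDiffAt_kern {n : ℕ} {s : ℝ} {y : Space n} (h : ‖y‖ ^ 2 + s ≠ 0) :
    ContDiffAt ℝ ∞ (kern n s) y :=
  (((contDiff_norm_sq ℝ).contDiffAt.add contDiffAt_const).rpow_const_of_ne h).smul
    (conjVec n).contDiff.contDiffAt

theorem inner_single_eq {n : ℕ} (y : Space n) (j : Fin (n + 1)) :
    inner ℝ y (EuclideanSpace.single j (1 : ℝ)) = y j := by
  simp [EuclideanSpace.inner_single_right]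

theorem rpow_kern_identity {n : ℕ} {s : ℝ} {y : Space n} (h : 0 < ‖y‖ ^ 2 + s) :
    (‖y‖ ^ 2 + s) ^ (-((n : ℝ) + 1) / 2) * ((n : ℝ) + 1) -
      ((n : ℝ) + 1) * (‖y‖ ^ 2 + s) ^ (-((n : ℝ) + 3) / 2) * ‖y‖ ^ 2 =
      ((n : ℝ) + 1) * s * (‖y‖ ^ 2 + s) ^ (-((n : ℝ) + 3) / 2) := by
  have : (-((n : ℝ) + 1) / 2) = -((n : ℝ) + 3) / 2 + 1 := by ring
  rw [this, Real.rpow_add_one h.ne']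
  ring

/-- The terms surviving at `s = 0` cancel because `conj y * y = |y|²`. For `s = 0` the kernel is
therefore monogenic off the origin; for `s > 0` the remainder is a positive bump of Poisson type.
This is the right-hand action, needed for integration by parts; the left-hand one below gives
monogenicity of the potential. -/
theorem sum_kernDeriv_mul_e {n : ℕ} {s : ℝ} {y : Space n} (h : 0 < ‖y‖ ^ 2 + s) :
    ∑ j, kernDeriv n s y (EuclideanSpace.single j 1) * e j =
      (((n : ℝ) + 1) * s * (‖y‖ ^ 2 + s) ^ (-((n : ℝ) + 3) / 2)) • (1 : Cl n) := by
  have key : ∀ j : Fin (n + 1), kernDeriv n s y (EuclideanSpace.single j 1) * e j =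
      (‖y‖ ^ 2 + s) ^ (-((n : ℝ) + 1) / 2) • (1 : Cl n) -
      (((n : ℝ) + 1) * (‖y‖ ^ 2 + s) ^ (-((n : ℝ) + 3) / 2)) •
        (conjVec n y * (y j • e j)) := by
    intro j
    simp only [kernDeriv, sub_apply, smul_apply,
      ContinuousLinearMap.smulRight_apply, innerSL_apply_apply, inner_single_eq, sub_mul,
      smul_mul_assoc, conjVec_single_mul_e, mul_smul_comm]
  simp only [key, Finset.sum_sub_distrib, ← Finset.smul_sum, ← Finset.mul_sum, ← vec_apply,
    conjVec_mul_vec, ← rpow_kern_identity h]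
  simp only [Finset.sum_const, Finset.card_univ, Fintype.card_fin]
  rw [← Nat.cast_smul_eq_nsmul ℝ]
  push_cast
  module

theorem sum_e_mul_kernDeriv {n : ℕ} {s : ℝ} {y : Space n} (h : 0 < ‖y‖ ^ 2 + s) :
    ∑ j, e j * kernDeriv n s y (EuclideanSpace.single j 1) =
      (((n : ℝ) + 1) * s * (‖y‖ ^ 2 + s) ^ (-((n : ℝ) + 3) / 2)) • (1 : Cl n) := by
  have key : ∀ j : Fin (n + 1), e j * kernDeriv n s y (EuclideanSpace.single j 1) =
      (‖y‖ ^ 2 + s) ^ (-((n : ℝ) + 1) / 2) • (1 : Cl n) -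
      (((n : ℝ) + 1) * (‖y‖ ^ 2 + s) ^ (-((n : ℝ) + 3) / 2)) •
        ((y j • e j) * conjVec n y) := by
    intro j
    simp only [kernDeriv, sub_apply, smul_apply,
      ContinuousLinearMap.smulRight_apply, innerSL_apply_apply, inner_single_eq, mul_sub,
      smul_mul_assoc, e_mul_conjVec_single, mul_smul_comm]
  simp only [key, Finset.sum_sub_distrib, ← Finset.smul_sum, ← Finset.sum_mul, ← vec_apply,
    vec_mul_conjVec, ← rpow_kern_identity h]
  simp only [Finset.sum_const, Finset.card_univ, Fintype.card_fin]
  rw [← Nat.cast_smul_eq_nsmul ℝ]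
  push_cast
  module

theorem norm_kern_le {n : ℕ} {s : ℝ} (hs : 0 ≤ s) (y : Space n) :
    ‖kern n s y‖ ≤ ‖conjVec n‖ * (‖y‖ ^ n)⁻¹ := by
  rcases eq_or_ne y 0 with rfl | hy
  · simp only [kern, map_zero, smul_zero, norm_zero]; positivity
  have hy' : 0 < ‖y‖ := norm_pos_iff.2 hy
  have h1 : (‖y‖ ^ 2 + s) ^ (-((n : ℝ) + 1) / 2) ≤ (‖y‖ ^ (n + 1))⁻¹ := by
    calc (‖y‖ ^ 2 + s) ^ (-((n : ℝ) + 1) / 2) ≤ (‖y‖ ^ 2) ^ (-((n : ℝ) + 1) / 2) :=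
          Real.rpow_le_rpow_of_nonpos (by positivity) (by linarith)
            (by have : (0 : ℝ) ≤ n := n.cast_nonneg
                linarith)
      _ = (‖y‖ ^ (n + 1))⁻¹ := by
          rw [← Real.rpow_natCast ‖y‖ 2, ← Real.rpow_mul hy'.le, ← Real.rpow_natCast ‖y‖ (n + 1),
            ← Real.rpow_neg hy'.le]
          congr 1; push_cast; ring
  rw [kern, norm_smul, Real.norm_of_nonneg (by positivity)]
  calc _ ≤ (‖y‖ ^ (n + 1))⁻¹ * (‖conjVec n‖ * ‖y‖) := by
        gcongr
        exact (conjVec n).le_opNorm y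
    _ = _ := by field_simp; ring

theorem continuous_kern {n : ℕ} {s : ℝ} (hs : 0 < s) : Continuous (kern n s) :=
  continuous_iff_continuousAt.2 fun y =>
    (hasFDerivAt_kern (by positivity : ‖y‖ ^ 2 + s ≠ 0)).continuousAt

theorem measurable_kern_zero (n : ℕ) : AEStronglyMeasurable (kern n 0) volume := by
  have : AEMeasurable (fun y : Space n => (‖y‖ ^ 2 + 0) ^ (-((n : ℝ) + 1) / 2)) volume := by
    fun_prop
  exact this.aestronglyMeasurable.smul (conjVec n).continuous.aestronglyMeasurable

/-! ### Integrals of `|y|⁻ⁿ` -/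

theorem integrableOn_norm_pow_inv (n : ℕ) (r : ℝ) :
    IntegrableOn (fun y : Space n => (‖y‖ ^ n)⁻¹) (Metric.ball 0 r) := by
  refine (integrableOn_fun_norm_addHaar volume (f := fun t : ℝ => (t ^ n)⁻¹)).2 ?_
  have : IntegrableOn (fun _ : ℝ => (1 : ℝ)) (Set.Ioo 0 r) := by simp
  refine this.congr_fun (fun t ht => ?_) measurableSet_Ioo
  have ht : t ≠ 0 := ht.1.ne'
  simp [ht]

theorem exists_setIntegral_norm_pow_inv_eq (n : ℕ) :
    ∃ A : ℝ, 0 ≤ A ∧ ∀ r : ℝ, 0 ≤ r →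
      ∫ y in Metric.ball (0 : Space n) r, (‖y‖ ^ n)⁻¹ = A * r := by
  refine ⟨(n + 1 : ℕ) * volume.real (Metric.ball (0 : Space n) 1), by positivity,
    fun r hr => ?_⟩
  have h1 : ∫ y in Metric.ball (0 : Space n) r, (‖y‖ ^ n)⁻¹ =
      ∫ y : Space n, (Set.Iio r).indicator (fun t : ℝ => (t ^ n)⁻¹) ‖y‖ := by
    rw [← integral_indicator measurableSet_ball]
    congr 1 with y
    by_cases h : ‖y‖ < r <;> simp [h]
  have h2 : ∫ t in Set.Ioi (0 : ℝ), t ^ n • (Set.Iio r).indicator (fun t : ℝ => (t ^ n)⁻¹) t =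
      r := by
    have : ∫ t in Set.Ioi (0 : ℝ), t ^ n • (Set.Iio r).indicator (fun t : ℝ => (t ^ n)⁻¹) t =
        ∫ t in Set.Ioi (0 : ℝ), (Set.Iio r).indicator (fun _ => (1 : ℝ)) t := by
      refine setIntegral_congr_fun measurableSet_Ioi fun t (ht : 0 < t) => ?_
      by_cases h : t < r <;> simp [h, ht.ne']
    rw [this, setIntegral_indicator measurableSet_Iio]
    simp [Set.Ioi_inter_Iio, hr]
  rw [h1, integral_fun_norm_addHaar]
  simp only [finrank_euclideanSpace_fin, Nat.add_sub_cancel]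
  rw [h2]
  simp [mul_assoc]

/-- A set of finite measure in `ℝ^{n+1}` carries the kernel `|y|⁻ⁿ` with mass at most a constant
times `μ(S)^{1/(n+1)}`. -/
theorem exists_setIntegral_norm_pow_inv_le (n : ℕ) :
    ∃ B : ℝ, 0 < B ∧ ∀ S : Set (Space n), MeasurableSet S → volume S ≠ ⊤ →
      IntegrableOn (fun y : Space n => (‖y‖ ^ n)⁻¹) S ∧
      ∫ y in S, (‖y‖ ^ n)⁻¹ ≤ B * volume.real S ^ (1 / ((n : ℝ) + 1)) := by
  obtain ⟨A, hA, hball⟩ := exists_setIntegral_norm_pow_inv_eq n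
  -- `A` accounts for the ball of radius `r`, and `1` for the part of `S` outside it.
  refine ⟨A + 1, by positivity, fun S hS hfin => ?_⟩
  have hcompl : ∀ r : ℝ, 0 < r → ∀ y ∈ S \ Metric.ball 0 r, ‖(‖y‖ ^ n)⁻¹‖ ≤ (r ^ n)⁻¹ := by
    intro r hr y hy
    have hy : r ≤ ‖y‖ := by simpa using hy.2
    rw [Real.norm_of_nonneg (by positivity)]
    gcongr
  have hint : ∀ r : ℝ, 0 < r →
      IntegrableOn (fun y : Space n => (‖y‖ ^ n)⁻¹) (S \ Metric.ball 0 r) := fun r hr =>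
    IntegrableOn.of_bound (measure_lt_top_of_subset Set.sdiff_subset hfin)
      (by fun_prop) _
      (ae_restrict_of_forall_mem (hS.diff measurableSet_ball) (hcompl r hr))
  have hintS : IntegrableOn (fun y : Space n => (‖y‖ ^ n)⁻¹) S :=
    ((integrableOn_norm_pow_inv n 1).union (hint 1 one_pos)).mono_set (by
      rw [Set.union_sdiff_self]; exact Set.subset_union_right)
  refine ⟨hintS, ?_⟩
  have hn : (0 : ℝ) < (n : ℝ) + 1 := by positivity
  rcases eq_or_lt_of_le (measureReal_nonneg (μ := volume) (s := S)) with h0 | hpos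
  · have : volume S = 0 := (measureReal_eq_zero_iff hfin).1 h0.symm
    rw [setIntegral_measure_zero _ this]
    positivity
  -- With `r^{n+1} = μ(S)`, the bound `r⁻ⁿ` outside the ball contributes at most `r⁻ⁿ μ(S) = r`, the
  -- same order as the ball.
  set r : ℝ := volume.real S ^ (1 / ((n : ℝ) + 1)) with hr
  have hr0 : 0 < r := by positivity
  have hrn : r ^ (n + 1) = volume.real S := by
    rw [hr, ← Real.rpow_natCast, ← Real.rpow_mul hpos.le]
    push_cast
    rw [one_div_mul_cancel hn.ne', Real.rpow_one]
  have hsub : S ⊆ Metric.ball 0 r ∪ S \ Metric.ball 0 r := by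
    rw [Set.union_sdiff_self]; exact Set.subset_union_right
  calc ∫ y in S, (‖y‖ ^ n)⁻¹
      ≤ ∫ y in Metric.ball 0 r ∪ S \ Metric.ball 0 r, (‖y‖ ^ n)⁻¹ :=
        setIntegral_mono_set ((integrableOn_norm_pow_inv n r).union (hint r hr0))
          (Eventually.of_forall fun y => by simp only [Pi.zero_apply]; positivity)
          (LE.le.eventuallyLE hsub)
    _ = A * r + ∫ y in S \ Metric.ball 0 r, (‖y‖ ^ n)⁻¹ := by
        rw [setIntegral_union Set.disjoint_sdiff_right (hS.diff measurableSet_ball)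
          (integrableOn_norm_pow_inv n r) (hint r hr0), hball r hr0.le]
    _ ≤ A * r + (r ^ n)⁻¹ * volume.real (S \ Metric.ball 0 r) := by
        gcongr
        exact (Real.le_norm_self _).trans (norm_setIntegral_le_of_norm_le_const
          (measure_lt_top_of_subset Set.sdiff_subset hfin) (hcompl r hr0))
    _ ≤ A * r + (r ^ n)⁻¹ * volume.real S := by
        gcongr
        exact Set.sdiff_subset
    _ = (A + 1) * r := by
        rw [← hrn, pow_succ]; field_simp

/-! ### The Cauchy–Pompeiu formula for compactly supported functions -/

/-- The homogeneous Dirac operator `∑ e_j ∂u/∂x_j`. -/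
noncomputable def dirac {n : ℕ} (u : Space n → Cl n) (x : Space n) : Cl n :=
  ∑ j, e j * pd j u x

theorem continuous_dirac {n : ℕ} {u : Space n → Cl n} (hu : ContDiff ℝ 1 u) :
    Continuous (dirac u) :=
  continuous_finsetSum _ fun _ _ => continuous_mulCl continuous_const
    ((hu.continuous_fderiv one_ne_zero).clm_apply continuous_const)

theorem dirac_eq_zero_of_fderiv_eq_zero {n : ℕ} {u : Space n → Cl n} {x : Space n}
    (h : fderiv ℝ u x = 0) : dirac u x = 0 := by
  simp [dirac, pd, h]

theorem hasCompactSupport_dirac {n : ℕ} {u : Space n → Cl n} (hu : HasCompactSupport u) :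
    HasCompactSupport (dirac u) :=
  (hu.fderiv ℝ).mono' fun _ hx => subset_closure fun h =>
    hx (dirac_eq_zero_of_fderiv_eq_zero h)

theorem dirac_congr {n : ℕ} {u v : Space n → Cl n} {x : Space n} (h : u =ᶠ[𝓝 x] v) :
    dirac u x = dirac v x := by
  simp only [dirac, pd, h.fderiv_eq]

theorem dirac_const_smul {n : ℕ} {u : Space n → Cl n} {x : Space n} (a : ℝ)
    (hu : DifferentiableAt ℝ u x) :
    dirac (fun y => a • u y) x = a • dirac u x := by
  simp only [dirac, pd, fderiv_fun_const_smul hu, smul_apply, mul_smul_comm, Finset.smul_sum]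

theorem dirac_comp_sub_left {n : ℕ} {u : Space n → Cl n} (hu : Differentiable ℝ u)
    (x z : Space n) : dirac (fun z => u (x - z)) z = -dirac u (x - z) := by
  have h : HasFDerivAt (fun z => u (x - z))
      ((fderiv ℝ u (x - z)).comp (-ContinuousLinearMap.id ℝ (Space n))) z :=
    (hu (x - z)).hasFDerivAt.comp z ((hasFDerivAt_id z).const_sub x)
  simp [dirac, pd, h.fderiv]

theorem integrable_mulCl {n : ℕ} {f g : Space n → Cl n} (hf : Continuous f) (hg : Continuous g)
    (hc : HasCompactSupport g) : Integrable fun z => f z * g z :=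
  (continuous_mulCl hf hg).integrable_of_hasCompactSupport
    (hc.mono' fun _ hx => subset_closure fun h => hx (by simp [h]))

/-- Integration by parts in each coordinate moves `∂_j` onto `kern n s * e_j`; summing over `j`
gives the Poisson-type bump. -/
theorem integral_kern_mul_dirac {n : ℕ} {s : ℝ} (hs : 0 < s) {v : Space n → Cl n}
    (hv : ContDiff ℝ 1 v) (hc : HasCompactSupport v) :
    ∫ z, kern n s z * dirac v z =
      -∫ z, (((n : ℝ) + 1) * s * (‖z‖ ^ 2 + s) ^ (-((n : ℝ) + 3) / 2)) • v z := by
  have hpos : ∀ z : Space n, 0 < ‖z‖ ^ 2 + s := fun z => by positivity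
  have hk1 : ContDiff ℝ 1 (kern n s) :=
    contDiff_iff_contDiffAt.2 fun y => (contDiffAt_kern (hpos y).ne').of_le (by simp)
  have hD : ∀ z, fderiv ℝ (kern n s) z = kernDeriv n s z := fun z =>
    (hasFDerivAt_kern (hpos z).ne').fderiv
  have hDc : Continuous (kernDeriv n s) := by
    rw [← funext hD]; exact hk1.continuous_fderiv one_ne_zero
  have hpdc : ∀ j : Fin (n + 1), Continuous (pd j v) := fun j =>
    (hv.continuous_fderiv one_ne_zero).clm_apply continuous_const
  have hpds : ∀ j : Fin (n + 1), HasCompactSupport (pd j v) := fun j => hc.fderiv_apply ℝ _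
  have hkc := continuous_kern (n := n) hs
  have hfc : ∀ j : Fin (n + 1), Continuous fun z => kern n s z * e j := fun j =>
    continuous_mulCl hkc continuous_const
  have hfc' : ∀ j : Fin (n + 1),
      Continuous fun z => kernDeriv n s z (EuclideanSpace.single j 1) * e j := fun j =>
    continuous_mulCl (hDc.clm_apply continuous_const) continuous_const
  have hparts : ∀ j : Fin (n + 1), ∫ z, (kern n s z * e j) * pd j v z =
      -∫ z, (kernDeriv n s z (EuclideanSpace.single j 1) * e j) * v z := by
    intro j
    refine integral_bilinear_hasFDerivAt_right_eq_neg_left_of_integrable (B := mulL n)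
      (f := fun z => kern n s z * e j)
      (f' := fun z => ((mulL n).flip (e j)).comp (kernDeriv n s z))
      (g := v) (g' := fderiv ℝ v) (v := EuclideanSpace.single j 1) ?_ ?_ ?_ ?_ ?_
    · exact integrable_mulCl (hfc' j) hv.continuous hc
    · exact integrable_mulCl (hfc j) (hpdc j) (hpds j)
    · exact integrable_mulCl (hfc j) hv.continuous hc
    · exact fun z _ => ((mulL n).flip (e j)).hasFDerivAt.comp z (hasFDerivAt_kern (hpos z).ne')
    · exact fun z _ => (hv.differentiable one_ne_zero z).hasFDerivAt
  calc ∫ z, kern n s z * dirac v z = ∫ z, ∑ j, (kern n s z * e j) * pd j v z := by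
        simp only [dirac, Finset.mul_sum, mul_assoc]
    _ = ∑ j, ∫ z, (kern n s z * e j) * pd j v z :=
        integral_finsetSum _ fun j _ => integrable_mulCl (hfc j) (hpdc j) (hpds j)
    _ = -∑ j, ∫ z, (kernDeriv n s z (EuclideanSpace.single j 1) * e j) * v z := by
        simp only [hparts, Finset.sum_neg_distrib]
    _ = -∫ z, ∑ j, (kernDeriv n s z (EuclideanSpace.single j 1) * e j) * v z := by
        rw [integral_finsetSum _ fun j _ => integrable_mulCl (hfc' j) hv.continuous hc]
    _ = _ := by
        simp only [← Finset.sum_mul, sum_kernDeriv_mul_e (hpos _), smul_mul_assoc, one_mul]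

/-- The normalisation constant of the Cauchy kernel. -/
noncomputable def kernConst (n : ℕ) : ℝ :=
  ∫ y : Space n, ((n : ℝ) + 1) * (1 + ‖y‖ ^ 2) ^ (-((n : ℝ) + 3) / 2)

theorem integrable_poisson (n : ℕ) :
    Integrable fun y : Space n => ((n : ℝ) + 1) * (1 + ‖y‖ ^ 2) ^ (-((n : ℝ) + 3) / 2) :=
  (integrable_rpow_neg_one_add_norm_sq (by
    rw [finrank_euclideanSpace_fin]; push_cast; linarith)).const_mul _

theorem kernConst_pos (n : ℕ) : 0 < kernConst n := by
  refine (integral_pos_iff_support_of_nonneg (fun y => by positivity)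
    (integrable_poisson n)).2 ?_
  have : (Function.support fun y : Space n =>
      ((n : ℝ) + 1) * (1 + ‖y‖ ^ 2) ^ (-((n : ℝ) + 3) / 2)) = Set.univ := by
    refine Set.eq_univ_of_forall fun y => ?_
    have : 0 < ((n : ℝ) + 1) * (1 + ‖y‖ ^ 2) ^ (-((n : ℝ) + 3) / 2) := by positivity
    exact this.ne'
  rw [this]
  exact Measure.measure_univ_pos.2 (NeZero.ne _)

/-- Substitute `z = ε w`: the Jacobian `ε^{n+1}` and the factor `ε²` cancel the `ε^{-(n+3)}` from
the power. -/
theorem integral_poisson_smul {n : ℕ} {ε : ℝ} (hε : 0 < ε) (v : Space n → Cl n) :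
    ∫ z, (((n : ℝ) + 1) * ε ^ 2 * (‖z‖ ^ 2 + ε ^ 2) ^ (-((n : ℝ) + 3) / 2)) • v z =
      ∫ w, (((n : ℝ) + 1) * (1 + ‖w‖ ^ 2) ^ (-((n : ℝ) + 3) / 2)) • v (ε • w) := by
  have h := Measure.integral_comp_smul volume (fun z : Space n =>
    (((n : ℝ) + 1) * ε ^ 2 * (‖z‖ ^ 2 + ε ^ 2) ^ (-((n : ℝ) + 3) / 2)) • v z) ε
  rw [finrank_euclideanSpace_fin, abs_of_pos (by positivity)] at h
  rw [← inv_smul_eq_iff₀ (by positivity), ← integral_smul] at h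
  rw [← h]
  congr 1 with w
  rw [smul_smul, norm_smul, Real.norm_of_nonneg hε.le]
  congr 1
  have h1 : (ε * ‖w‖) ^ 2 + ε ^ 2 = ε ^ 2 * (1 + ‖w‖ ^ 2) := by ring
  have h2 : (ε ^ 2) ^ (-((n : ℝ) + 3) / 2) = (ε ^ (n + 3))⁻¹ := by
    rw [← Real.rpow_natCast ε 2, ← Real.rpow_mul hε.le, ← Real.rpow_natCast ε (n + 3),
      ← Real.rpow_neg hε.le]
    congr 1; push_cast; ring
  rw [h1, Real.mul_rpow (by positivity) (by positivity), h2]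
  field_simp
  ring

theorem tendsto_integral_poisson {n : ℕ} {v : Space n → Cl n} (hv : Continuous v)
    (hc : HasCompactSupport v) :
    Tendsto (fun ε : ℝ => ∫ w, (((n : ℝ) + 1) * (1 + ‖w‖ ^ 2) ^ (-((n : ℝ) + 3) / 2)) •
      v (ε • w)) (𝓝[>] 0) (𝓝 (kernConst n • v 0)) := by
  obtain ⟨M, hM⟩ := hv.bounded_above_of_compact_support hc
  rw [kernConst, ← integral_smul_const]
  refine tendsto_integral_filter_of_dominated_convergence
    (fun w => (((n : ℝ) + 1) * (1 + ‖w‖ ^ 2) ^ (-((n : ℝ) + 3) / 2)) * M)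
    (Eventually.of_forall fun ε => ?_) (Eventually.of_forall fun ε =>
      Eventually.of_forall fun w => ?_) ((integrable_poisson n).mul_const M)
    (Eventually.of_forall fun w => ?_)
  · exact (integrable_poisson n).aestronglyMeasurable.smul
      (hv.comp (continuous_const_smul ε)).aestronglyMeasurable
  · rw [norm_smul, Real.norm_of_nonneg (by positivity)]
    gcongr
    exact hM _
  · refine Tendsto.const_smul ?_ _
    have : Tendsto (fun ε : ℝ => v (ε • w)) (𝓝 0) (𝓝 (v ((0 : ℝ) • w))) :=
      (hv.comp (continuous_id.smul continuous_const)).tendsto 0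
    rw [zero_smul] at this
    exact this.mono_left nhdsWithin_le_nhds

theorem tendsto_kern {n : ℕ} (z : Space n) :
    Tendsto (fun ε : ℝ => kern n (ε ^ 2) z) (𝓝[>] 0) (𝓝 (kern n 0 z)) := by
  rcases eq_or_ne z 0 with rfl | hz
  · simp [kern]
  have h0 : ‖z‖ ^ 2 + (0 : ℝ) ^ 2 ≠ 0 := by simpa using hz
  have hc : ContinuousAt (fun ε : ℝ => (‖z‖ ^ 2 + ε ^ 2) ^ (-((n : ℝ) + 1) / 2)) 0 :=
    ContinuousAt.rpow_const (by fun_prop) (Or.inl h0)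
  have h := (hc.tendsto.mono_left (nhdsWithin_le_nhds (s := Set.Ioi 0))).smul_const (conjVec n z)
  simpa [kern] using h

/-- The Cauchy–Pompeiu formula at the origin, obtained by letting `s = ε²` tend to zero.
`norm_kern_le` is uniform in `s`, so a multiple of `|z|⁻ⁿ` on a ball containing the support
dominates. -/
theorem integral_kern_zero_mul_dirac {n : ℕ} {v : Space n → Cl n} (hv : ContDiff ℝ 1 v)
    (hc : HasCompactSupport v) :
    ∫ z, kern n 0 z * dirac v z = -(kernConst n • v 0) := by
  obtain ⟨M, hM⟩ := (continuous_dirac hv).bounded_above_of_compact_support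
    (hasCompactSupport_dirac hc)
  have hM0 : 0 ≤ M := (norm_nonneg _).trans (hM 0)
  obtain ⟨R, hR⟩ := (hasCompactSupport_dirac hc).isCompact.isBounded.subset_ball 0
  refine tendsto_nhds_unique (f := fun ε : ℝ => ∫ z, kern n (ε ^ 2) z * dirac v z)
    (l := 𝓝[>] 0) ?_ ?_
  · refine tendsto_integral_filter_of_dominated_convergence
      ((Metric.ball 0 R).indicator fun z => ‖mulL n‖ * (‖conjVec n‖ * (‖z‖ ^ n)⁻¹) * M)
      ?_ (Eventually.of_forall fun ε => Eventually.of_forall fun z => ?_)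
      ((integrable_indicator_iff measurableSet_ball).2
        ((((integrableOn_norm_pow_inv n R).const_mul _).const_mul _).mul_const M))
      (Eventually.of_forall fun z => ?_)
    · filter_upwards [self_mem_nhdsWithin] with ε hε
      exact (continuous_mulCl (continuous_kern (pow_pos hε 2))
        (continuous_dirac hv)).aestronglyMeasurable
    · by_cases hz : z ∈ Metric.ball (0 : Space n) R
      · rw [Set.indicator_of_mem hz]
        refine (norm_mul_le_mulL _ _).trans ?_
        gcongr
        · exact norm_kern_le (by positivity) z
        · exact hM z
      · rw [image_eq_zero_of_notMem_tsupport (fun h => hz (hR h)), mul_zero, norm_zero]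
        exact Set.indicator_nonneg (fun z _ => by positivity) z
    · exact ((mulL n).flip (dirac v z)).continuous.continuousAt.tendsto.comp (tendsto_kern z)
  · refine (tendsto_integral_poisson hv.continuous hc).neg.congr' ?_
    filter_upwards [self_mem_nhdsWithin] with ε (hε : 0 < ε)
    rw [integral_kern_mul_dirac (pow_pos hε 2) hv hc, integral_poisson_smul hε]

/-- The convolution of `k` with the (unnormalised) Cauchy kernel. -/
noncomputable def potential {n : ℕ} (k : Space n → Cl n) (x : Space n) : Cl n :=
  ∫ y, kern n 0 (x - y) * k y

theorem potential_dirac {n : ℕ} {u : Space n → Cl n} (hu : ContDiff ℝ 1 u)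
    (hc : HasCompactSupport u) (x : Space n) :
    potential (dirac u) x = kernConst n • u x := by
  have h := integral_kern_zero_mul_dirac (v := fun z => u (x - z))
    (hu.comp (contDiff_const.sub contDiff_id))
    (hc.comp_homeomorph (Homeomorph.subLeft x))
  simp only [dirac_comp_sub_left (hu.differentiable one_ne_zero), mul_neg, integral_neg,
    neg_inj, sub_zero] at h
  rw [← h, potential,
    ← integral_sub_left_eq_self (fun z => kern n 0 z * dirac u (x - z)) volume x]
  simp

/-! ### The Cauchy transform of bounded functions -/

theorem exists_norm_potential_le (n : ℕ) :
    ∃ B : ℝ, 0 < B ∧ ∀ (k : Space n → Cl n) (M : ℝ) (S : Set (Space n)),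
      AEStronglyMeasurable k volume → (∀ y, ‖k y‖ ≤ M) → MeasurableSet S → volume S ≠ ⊤ →
      (∀ y ∉ S, k y = 0) → ∀ x : Space n,
      Integrable (fun y => kern n 0 (x - y) * k y) ∧
        ‖potential k x‖ ≤ B * M * volume.real S ^ (1 / ((n : ℝ) + 1)) := by
  obtain ⟨B, hB0, hB⟩ := exists_setIntegral_norm_pow_inv_le n
  -- The summand `1` only makes positivity of the constant immediate.
  refine ⟨(‖mulL n‖ * ‖conjVec n‖ + 1) * B, by positivity, fun k M S hk hM hS hfin hkS x => ?_⟩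
  have hM0 : 0 ≤ M := (norm_nonneg _).trans (hM 0)
  have hmp : MeasurePreserving (fun z : Space n => x - z) volume volume :=
    Measure.measurePreserving_sub_left volume x
  have hS' : MeasurableSet ((fun z : Space n => x - z) ⁻¹' S) := hmp.measurable hS
  have hvol : volume ((fun z : Space n => x - z) ⁻¹' S) = volume S :=
    hmp.measure_preimage hS.nullMeasurableSet
  obtain ⟨hint, hle⟩ := hB _ hS' (by rwa [hvol])
  rw [measureReal_def, hvol, ← measureReal_def] at hle
  set b : Space n → ℝ := ((fun z : Space n => x - z) ⁻¹' S).indicator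
    fun z => ‖mulL n‖ * ‖conjVec n‖ * M * (‖z‖ ^ n)⁻¹ with hb
  have hbint : Integrable b := (integrable_indicator_iff hS').2 (hint.const_mul _)
  have hbound : ∀ z, ‖kern n 0 z * k (x - z)‖ ≤ b z := by
    intro z
    by_cases hz : x - z ∈ S
    · rw [hb, Set.indicator_of_mem (by exact hz)]
      calc _ ≤ ‖mulL n‖ * ‖kern n 0 z‖ * ‖k (x - z)‖ := norm_mul_le_mulL _ _
        _ ≤ ‖mulL n‖ * (‖conjVec n‖ * (‖z‖ ^ n)⁻¹) * M := by
            gcongr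
            · exact norm_kern_le le_rfl z
            · exact hM _
        _ = _ := by ring
    · rw [hb, Set.indicator_of_notMem (by exact hz), hkS _ hz, mul_zero, norm_zero]
  have hmeas : AEStronglyMeasurable (fun z => kern n 0 z * k (x - z)) volume :=
    (mulL n).aestronglyMeasurable_comp₂ (measurable_kern_zero n)
      (hk.comp_quasiMeasurePreserving hmp.quasiMeasurePreserving)
  have hH : Integrable (fun z => kern n 0 z * k (x - z)) :=
    hbint.mono' hmeas (Eventually.of_forall hbound)
  refine ⟨by simpa using hH.comp_sub_left x, ?_⟩
  have hpot : potential k x = ∫ z, kern n 0 z * k (x - z) := by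
    rw [potential, ← integral_sub_left_eq_self (fun z => kern n 0 z * k (x - z)) volume x]
    simp
  rw [hpot]
  calc _ ≤ ∫ z, b z := norm_integral_le_of_norm_le hbint (Eventually.of_forall hbound)
    _ = ‖mulL n‖ * ‖conjVec n‖ * M *
          ∫ z in (fun z : Space n => x - z) ⁻¹' S, (‖z‖ ^ n)⁻¹ := by
        rw [hb, integral_indicator hS', integral_const_mul]
    _ ≤ ‖mulL n‖ * ‖conjVec n‖ * M * (B * volume.real S ^ (1 / ((n : ℝ) + 1))) := by gcongr
    _ ≤ (‖mulL n‖ * ‖conjVec n‖ + 1) * M * (B * volume.real S ^ (1 / ((n : ℝ) + 1))) := by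
        gcongr; linarith
    _ = _ := by ring

/-- Away from the support of its density, the Cauchy transform is `C¹` and monogenic. -/
theorem potential_monogenic_of_zero {n : ℕ} {k : Space n → Cl n} {R r : ℝ} {x₀ : Space n}
    (hk : LocallyIntegrable k volume) (hR : ∀ y, y ∉ Metric.ball (0 : Space n) R → k y = 0)
    (hr : 0 < r) (hzero : ∀ y ∈ Metric.ball x₀ r, k y = 0) :
    ContDiffAt ℝ 1 (potential k) x₀ ∧ dirac (potential k) x₀ = 0 := by
  set R' : ℝ := |R| + ‖x₀‖ + 2 * r with hR'
  have hR'0 : 0 < R' := by positivity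
  let b₁ : ContDiffBump (0 : Space n) := ⟨r / 4, r / 2, by linarith, by linarith⟩
  let b₂ : ContDiffBump (0 : Space n) := ⟨R', 2 * R', hR'0, by linarith⟩
  -- Cutting the kernel off near zero and far away makes it `C¹` with compact support, so that
  -- convolutions with it may be differentiated. For `x` near `x₀`, the points where `k` is nonzero
  -- satisfy `r / 2 < |x - y| < R'`, where the cutoff equals `1`.
  let ψ : Space n → ℝ := fun z => b₂ z * (1 - b₁ z)
  have hψ : ContDiff ℝ 1 ψ := b₂.contDiff.mul (contDiff_const.sub b₁.contDiff)
  have hψ1 : ∀ z : Space n, r / 2 < ‖z‖ → ‖z‖ < R' → ψ =ᶠ[𝓝 z] 1 := by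
    intro z h1 h2
    have hopen : IsOpen {w : Space n | r / 2 < ‖w‖} := isOpen_lt continuous_const continuous_norm
    filter_upwards [hopen.mem_nhds h1, b₂.eventuallyEq_one_of_mem_ball (x := z) (by simpa using h2)]
      with w hw1 hw2
    have : b₁ w = 0 := b₁.zero_of_le_dist (by simpa using le_of_lt hw1)
    simp only [Pi.one_apply] at hw2
    simp [ψ, hw2, this]
  let E : Space n → Cl n := fun z => ψ z • kern n 0 z
  have hE : ContDiff ℝ 1 E := by
    refine contDiff_iff_contDiffAt.2 fun z => ?_
    rcases eq_or_ne z 0 with rfl | hz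
    · have : E =ᶠ[𝓝 0] fun _ => 0 := by
        filter_upwards [b₁.eventuallyEq_one] with w hw
        simp only [Pi.one_apply] at hw
        simp [E, ψ, hw]
      exact contDiffAt_const.congr_of_eventuallyEq this
    · exact hψ.contDiffAt.smul ((contDiffAt_kern (by simpa using hz)).of_le (by simp))
  have hEc : HasCompactSupport E := (b₂.hasCompactSupport.mul_right).smul_right
  have hE1 : ∀ z : Space n, r / 2 < ‖z‖ → ‖z‖ < R' → E =ᶠ[𝓝 z] kern n 0 := by
    intro z h1 h2
    filter_upwards [hψ1 z h1 h2] with w hw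
    simp [E, hw]
  have hconv : ∀ x ∈ Metric.ball x₀ (r / 2),
      potential k x = convolution k E (mulL n).flip volume x := by
    intro x hx
    rw [potential, convolution]
    congr 1 with y
    change _ = E (x - y) * k y
    by_cases hy : k y = 0
    · simp [hy]
    have hyr : r ≤ dist y x₀ := by
      by_contra h
      exact hy (hzero y (not_le.1 h))
    have hyR : ‖y‖ < R := by
      by_contra h
      exact hy (hR y (by simpa using h))
    rw [Metric.mem_ball] at hx
    have h1 : r / 2 < ‖x - y‖ := by
      rw [← dist_eq_norm]
      have := dist_triangle y x x₀
      rw [dist_comm y x] at this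
      linarith
    have h2 : ‖x - y‖ < R' := by
      have h3 := norm_sub_le x y
      have h4 : ‖x‖ ≤ ‖x₀‖ + r / 2 := by
        have := norm_le_norm_add_norm_sub' x x₀
        rw [dist_eq_norm] at hx
        linarith
      have := le_abs_self R
      linarith
    rw [(hE1 _ h1 h2).self_of_nhds]
  have hev : potential k =ᶠ[𝓝 x₀] convolution k E (mulL n).flip volume := by
    filter_upwards [Metric.ball_mem_nhds x₀ (half_pos hr)] with x hx using hconv x hx
  have hderiv := hEc.hasFDerivAt_convolution_right (mulL n).flip hk hE x₀
  refine ⟨((hEc.contDiff_convolution_right (mulL n).flip hk hE).contDiffAt).congr_of_eventuallyEq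
    hev, ?_⟩
  rw [dirac_congr hev]
  have hfc : Continuous (fderiv ℝ E) := hE.continuous_fderiv one_ne_zero
  have hint : ∀ j : Fin (n + 1), Integrable fun y =>
      fderiv ℝ E (x₀ - y) (EuclideanSpace.single j 1) * k y := fun j =>
    (hEc.fderiv_apply ℝ _).convolutionExists_right (mulL n).flip hk
      (hfc.clm_apply continuous_const) x₀
  have hpd : ∀ j : Fin (n + 1), e j * pd j (convolution k E (mulL n).flip volume) x₀ =
      ∫ y, e j * (fderiv ℝ E (x₀ - y) (EuclideanSpace.single j 1) * k y) := by
    intro j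
    rw [pd, hderiv.fderiv, convolution_precompR_apply _ hk (hEc.fderiv ℝ) hfc]
    exact ((mulL n (e j)).integral_comp_comm (hint j)).symm
  simp only [dirac, hpd]
  have hint' : ∀ j : Fin (n + 1), Integrable fun y =>
      e j * (fderiv ℝ E (x₀ - y) (EuclideanSpace.single j 1) * k y) := fun j =>
    (mulL n (e j)).integrable_comp (hint j)
  rw [← integral_finsetSum _ fun j _ => hint' j]
  refine (integral_congr_ae (Eventually.of_forall fun y => ?_)).trans (integral_zero _ _)
  by_cases hy : k y = 0
  · simp [hy]
  have hyr : r ≤ ‖x₀ - y‖ := by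
    by_contra h
    refine hy (hzero y ?_)
    rw [Metric.mem_ball, dist_comm, dist_eq_norm]
    exact not_le.1 h
  have hyR : ‖y‖ < R := by
    by_contra h
    exact hy (hR y (by simpa using h))
  have h2 : ‖x₀ - y‖ < R' := by
    have := norm_sub_le x₀ y
    have := le_abs_self R
    linarith
  have hpos : 0 < ‖x₀ - y‖ ^ 2 + 0 := by
    have : 0 < ‖x₀ - y‖ := hr.trans_le hyr
    positivity
  have hfd : fderiv ℝ E (x₀ - y) = kernDeriv n 0 (x₀ - y) := by
    rw [(hE1 _ (by linarith) h2).fderiv_eq, (hasFDerivAt_kern hpos.ne').fderiv]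
  simp only [hfd, ← mul_assoc, ← Finset.sum_mul, sum_e_mul_kernDeriv hpos]
  simp

theorem locallyIntegrable_of_bound {n : ℕ} {k : Space n → Cl n} {M : ℝ}
    (hk : AEStronglyMeasurable k volume) (hM : ∀ y, ‖k y‖ ≤ M) : LocallyIntegrable k volume :=
  (locallyIntegrable_const M).mono hk (Eventually.of_forall fun y =>
    (hM y).trans (Real.le_norm_self M))

/-- Split `k` at a small ball about `x₀`: the inner part has a uniformly small potential by the
volume estimate, and the outer part vanishes near `x₀`, so its potential is `C¹` there. -/
theorem continuous_potential {n : ℕ} {k : Space n → Cl n} {M R : ℝ}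
    (hk : AEStronglyMeasurable k volume) (hM : ∀ y, ‖k y‖ ≤ M)
    (hR : ∀ y, y ∉ Metric.ball (0 : Space n) R → k y = 0) : Continuous (potential k) := by
  obtain ⟨B, hB0, hB⟩ := exists_norm_potential_le n
  have hM0 : 0 ≤ M := (norm_nonneg _).trans (hM 0)
  refine continuous_iff_continuousAt.2 fun x₀ => Metric.continuousAt_iff'.2 fun ε hε => ?_
  have hlim : Tendsto (fun r : ℝ => B * M *
      volume.real (Metric.ball x₀ r) ^ (1 / ((n : ℝ) + 1))) (𝓝[>] 0) (𝓝 0) := by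
    have hn : (0 : ℝ) < 1 / ((n : ℝ) + 1) := by positivity
    have h1 : Tendsto (fun r : ℝ => r ^ (n + 1) * volume.real (Metric.ball (0 : Space n) 1))
        (𝓝[>] 0) (𝓝 0) := by
      have : Continuous fun r : ℝ => r ^ (n + 1) * volume.real (Metric.ball (0 : Space n) 1) := by
        fun_prop
      simpa using (this.tendsto 0).mono_left nhdsWithin_le_nhds
    have h2 := (h1.rpow_const (p := 1 / ((n : ℝ) + 1)) (Or.inr hn.le)).const_mul (B * M)
    rw [Real.zero_rpow hn.ne', mul_zero] at h2
    refine h2.congr' ?_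
    filter_upwards [self_mem_nhdsWithin] with r (hr : 0 < r)
    rw [measureReal_def (s := Metric.ball x₀ r), Measure.addHaar_ball_of_pos _ _ hr,
      ENNReal.toReal_mul, ENNReal.toReal_ofReal (by positivity), finrank_euclideanSpace_fin]
    rfl
  obtain ⟨r, hrε, hr⟩ := ((hlim.eventually (gt_mem_nhds (by positivity : 0 < ε / 3))).and
    self_mem_nhdsWithin).exists
  have hr : 0 < r := hr
  set k₁ := (Metric.ball x₀ r).indicator k with hk₁
  set k₂ := (Metric.ball x₀ r)ᶜ.indicator k with hk₂
  have hk₁m : AEStronglyMeasurable k₁ volume := hk.indicator measurableSet_ball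
  have hk₂m : AEStronglyMeasurable k₂ volume := hk.indicator measurableSet_ball.compl
  have hk₁M : ∀ y, ‖k₁ y‖ ≤ M := fun y => (norm_indicator_le_norm_self _ _).trans (hM y)
  have hk₂M : ∀ y, ‖k₂ y‖ ≤ M := fun y => (norm_indicator_le_norm_self _ _).trans (hM y)
  have hk₂R : ∀ y, y ∉ Metric.ball (0 : Space n) R → k₂ y = 0 := fun y hy => by
    rw [hk₂, Set.indicator_apply_eq_zero]; exact fun _ => hR y hy
  have h₁ := hB k₁ M (Metric.ball x₀ r) hk₁m hk₁M measurableSet_ball measure_ball_lt_top.ne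
    (fun y hy => Set.indicator_of_notMem hy _)
  have h₂ := hB k₂ M (Metric.ball 0 R) hk₂m hk₂M measurableSet_ball measure_ball_lt_top.ne hk₂R
  have hsplit : ∀ x, potential k x = potential k₁ x + potential k₂ x := by
    intro x
    simp only [potential]
    rw [← integral_add (h₁ x).1 (h₂ x).1]
    congr 1 with y
    rw [← mul_add, ← Pi.add_apply, hk₁, hk₂, Set.indicator_self_add_compl]
  have hcont : ContinuousAt (potential k₂) x₀ :=
    (potential_monogenic_of_zero (locallyIntegrable_of_bound hk₂m hk₂M) hk₂R hr
      (fun y hy => Set.indicator_of_notMem (by simpa using hy) _)).1.continuousAt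
  filter_upwards [Metric.continuousAt_iff'.1 hcont (ε / 3) (by positivity)] with x hx
  rw [hsplit, hsplit]
  calc _ ≤ dist (potential k₁ x) (potential k₁ x₀) + dist (potential k₂ x) (potential k₂ x₀) :=
        dist_add_add_le _ _ _ _
    _ ≤ ‖potential k₁ x‖ + ‖potential k₁ x₀‖ + dist (potential k₂ x) (potential k₂ x₀) := by
        gcongr; exact dist_le_norm_add_norm _ _
    _ < ε := by linarith [(h₁ x).2, (h₁ x₀).2]

/-! ### Solving the Dirac equation -/

/-- Subtracting from a `C¹` function the normalised Cauchy transform of its Dirac derivative gives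
a monogenic function. -/
theorem sub_potential_dirac_monogenic {n : ℕ} {V : Set (Space n)} (hV : IsOpen V) {R M : ℝ}
    (hVR : V ⊆ Metric.ball 0 R) {u : Space n → Cl n} (hu : ContDiffOn ℝ 1 u V)
    (hG : AEStronglyMeasurable (V.indicator (dirac u)) volume)
    (hM : ∀ y, ‖V.indicator (dirac u) y‖ ≤ M) {x₀ : Space n} (hx₀ : x₀ ∈ V) :
    ContDiffAt ℝ 1 (fun x => u x - (kernConst n)⁻¹ • potential (V.indicator (dirac u)) x) x₀ ∧
      dirac (fun x => u x - (kernConst n)⁻¹ • potential (V.indicator (dirac u)) x) x₀ = 0 := by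
  obtain ⟨B, -, hB⟩ := exists_norm_potential_le n
  obtain ⟨δ, hδ, hδV⟩ := Metric.nhds_basis_closedBall.mem_iff.1 (hV.mem_nhds hx₀)
  let b : ContDiffBump x₀ := ⟨δ / 2, δ, by linarith, by linarith⟩
  -- The potential of `G` need not be `C¹` by itself. Localising gives `v` with `potential (dirac v)
  -- = kernConst n • v`, while `G - dirac v` vanishes near `x₀` and so has a monogenic potential
  -- there.
  let v : Space n → Cl n := fun x => b x • u x
  have hbV : tsupport b ⊆ V := by rw [b.tsupport_eq]; exact hδV
  have hvV : tsupport v ⊆ V := (tsupport_smul_subset_left _ _).trans hbV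
  have hv : ContDiff ℝ 1 v := by
    refine contDiff_iff_contDiffAt.2 fun x => ?_
    by_cases hx : x ∈ V
    · exact b.contDiff.contDiffAt.smul (hu.contDiffAt (hV.mem_nhds hx))
    · exact contDiffAt_const.congr_of_eventuallyEq
        (notMem_tsupport_iff_eventuallyEq.1 fun h => hx (hvV h))
  have hvc : HasCompactSupport v := b.hasCompactSupport.smul_right
  have hDv := continuous_dirac hv
  have hDvV : ∀ y, y ∉ V → dirac v y = 0 := fun y hy =>
    dirac_eq_zero_of_fderiv_eq_zero (image_eq_zero_of_notMem_tsupport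
      fun h => hy (hvV (tsupport_fderiv_subset ℝ h)))
  obtain ⟨M', hM'⟩ := hDv.bounded_above_of_compact_support (hasCompactSupport_dirac hvc)
  set G := V.indicator (dirac u) with hGdef
  have hGV : ∀ y, y ∉ V → G y = 0 := fun y hy => Set.indicator_of_notMem hy _
  set k : Space n → Cl n := fun y => G y - dirac v y with hk
  have hvu : ∀ y ∈ Metric.ball x₀ (δ / 2), v =ᶠ[𝓝 y] u := by
    intro y hy
    filter_upwards [b.eventuallyEq_one_of_mem_ball hy] with z hz
    simp only [Pi.one_apply] at hz
    simp [v, hz]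
  have hkm : AEStronglyMeasurable k volume := hG.sub hDv.aestronglyMeasurable
  have hkM : ∀ y, ‖k y‖ ≤ M + M' := fun y => (norm_sub_le _ _).trans (add_le_add (hM y) (hM' y))
  have hkR : ∀ y, y ∉ Metric.ball (0 : Space n) R → k y = 0 := fun y hy => by
    have hy : y ∉ V := fun h => hy (hVR h)
    simp [hk, hGV y hy, hDvV y hy]
  have hk0 : ∀ y ∈ Metric.ball x₀ (δ / 2), k y = 0 := fun y hy => by
    have hyV : y ∈ V := hδV (Metric.ball_subset_closedBall.trans
      (Metric.closedBall_subset_closedBall (by linarith)) hy)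
    simp [hk, hGdef, hyV, dirac_congr (hvu y hy)]
  obtain ⟨hreg, hdir⟩ := potential_monogenic_of_zero (locallyIntegrable_of_bound hkm hkM) hkR
    (half_pos hδ) hk0
  have hsub : ∀ x, potential k x = potential G x - kernConst n • v x := by
    intro x
    rw [← potential_dirac hv hvc]
    simp only [potential, hk, mul_sub]
    exact integral_sub
      (hB G M _ hG hM measurableSet_ball measure_ball_lt_top.ne
        (fun y hy => hGV y fun h => hy (hVR h)) x).1
      (hB _ M' _ hDv.aestronglyMeasurable hM' measurableSet_ball measure_ball_lt_top.ne
        (fun y hy => hDvV y fun h => hy (hVR h)) x).1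
  have hev : (fun x => u x - (kernConst n)⁻¹ • potential G x) =ᶠ[𝓝 x₀]
      fun x => (-(kernConst n)⁻¹) • potential k x := by
    filter_upwards [hvu x₀ (Metric.mem_ball_self (half_pos hδ))] with x hx
    rw [hsub, hx, smul_sub, neg_smul, neg_smul, smul_smul,
      inv_mul_cancel₀ (kernConst_pos n).ne', one_smul]
    abel
  refine ⟨(hreg.const_smul (-(kernConst n)⁻¹)).congr_of_eventuallyEq hev, ?_⟩
  rw [dirac_congr hev, dirac_const_smul _ (hreg.differentiableAt one_ne_zero), hdir, smul_zero]

/-- Differentiating the factor `e^{-Γ}` produces exactly the terms `-γ_j f`, since real scalars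
commute with `e_j`. -/
theorem diracGamma_eq {n : ℕ} (Γ : Space n →L[ℝ] ℝ) {f : Space n → Cl n} {x : Space n}
    (hf : DifferentiableAt ℝ f x) :
    diracGamma Γ f x = Real.exp (Γ x) • dirac (fun y => Real.exp (-Γ y) • f y) x := by
  have h1 : HasFDerivAt (fun y => Real.exp (-Γ y)) (Real.exp (-Γ x) • -Γ) x :=
    (Γ.hasFDerivAt.neg).exp
  have h2 := h1.smul hf.hasFDerivAt
  simp only [diracGamma, dirac, Finset.smul_sum]
  refine Finset.sum_congr rfl fun j _ => ?_
  rw [← mul_smul_comm]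
  congr 1
  simp only [pd]
  rw [(show HasFDerivAt (fun y => Real.exp (-Γ y) • f y) _ x from h2).fderiv, Γ.fderiv]
  simp only [add_apply, smul_apply, ContinuousLinearMap.smulRight_apply, neg_apply,
    smul_add, smul_smul, smul_eq_mul, ← Real.exp_add, add_neg_cancel, Real.exp_zero, one_smul]
  rw [← mul_assoc, ← Real.exp_add, add_neg_cancel, Real.exp_zero, one_mul, neg_smul,
    sub_eq_add_neg]

/-- A `C¹` function on a bounded open set `V` is `γ`-regular up to a continuous function controlled
by `D_γ f` and the measure of `V`. -/
theorem exists_gammaRegular_correction (n : ℕ) :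
    ∃ β : ℝ, 0 < β ∧ ∀ (Γ : Space n →L[ℝ] ℝ) (V : Set (Space n)) (f : Space n → Cl n) (M : ℝ),
      IsOpen V → Bornology.IsBounded V → ContDiffOn ℝ 1 f V → 0 ≤ M →
      (∀ y ∈ V, ‖diracGamma Γ f y‖ ≤ M) →
      ∃ P : Space n → Cl n, Continuous P ∧ IsGammaRegularOn Γ (fun x => f x - P x) V ∧
        ∀ (K : ℝ) (x : Space n), (∀ y ∈ V, Γ x - Γ y ≤ K) →
          ‖P x‖ ≤ β * Real.exp K * volume.real V ^ (1 / ((n : ℝ) + 1)) * M := by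
  obtain ⟨B, hB0, hB⟩ := exists_norm_potential_le n
  have hc := kernConst_pos n
  refine ⟨(kernConst n)⁻¹ * B, by positivity, fun Γ V f M hV hVb hf hM0 hM => ?_⟩
  obtain ⟨R, hR⟩ := hVb.subset_ball 0
  have hVfin : volume V ≠ ⊤ := hVb.measure_lt_top.ne
  have hΓ : ContDiff ℝ 1 fun y => Γ y := Γ.contDiff
  set u : Space n → Cl n := fun y => Real.exp (-Γ y) • f y with hu_def
  have hu : ContDiffOn ℝ 1 u V := (hΓ.neg.exp.contDiffOn).smul hf
  set G := V.indicator (dirac u) with hG_def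
  have hGnorm : ∀ y ∈ V, ‖G y‖ ≤ Real.exp (-Γ y) * M := by
    intro y hy
    have h := hM y hy
    rw [diracGamma_eq Γ ((hf.contDiffAt (hV.mem_nhds hy)).differentiableAt one_ne_zero),
      norm_smul, Real.norm_of_nonneg (Real.exp_pos _).le] at h
    rw [hG_def, Set.indicator_of_mem hy, Real.exp_neg, ← div_eq_inv_mul,
      le_div_iff₀' (Real.exp_pos _)]
    exact h
  have hGzero : ∀ y, y ∉ V → G y = 0 := fun y hy => Set.indicator_of_notMem hy _
  have hGm : AEStronglyMeasurable G volume := by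
    rw [hG_def, aestronglyMeasurable_indicator_iff hV.measurableSet]
    refine ContinuousOn.aestronglyMeasurable ?_ hV.measurableSet
    exact continuousOn_finsetSum _ fun j _ => (mulL n (e j)).continuous.comp_continuousOn
      ((hu.continuousOn_fderiv_of_isOpen hV le_rfl).clm_apply continuousOn_const)
  -- This crude bound serves only for regularity and continuity; it depends on `Γ` and `R` and does
  -- not enter `β`.
  have hGbdd : ∀ y, ‖G y‖ ≤ Real.exp (‖Γ‖ * R) * M := by
    intro y
    by_cases hy : y ∈ V
    · refine (hGnorm y hy).trans ?_
      gcongr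
      have h1 := Γ.le_opNorm y
      have h2 : ‖y‖ ≤ R := le_of_lt (by simpa using hR hy)
      have h3 := neg_le_abs (Γ y)
      rw [Real.norm_eq_abs] at h1
      exact h3.trans (h1.trans (by gcongr))
    · rw [hGzero y hy, norm_zero]; positivity
  set w : Space n → Cl n := fun x => u x - (kernConst n)⁻¹ • potential G x with hw_def
  have hw : ∀ x ∈ V, ContDiffAt ℝ 1 w x ∧ dirac w x = 0 := fun x hx =>
    sub_potential_dirac_monogenic hV hR hu hGm hGbdd hx
  refine ⟨fun x => Real.exp (Γ x) • (kernConst n)⁻¹ • potential G x, ?_, ?_, ?_⟩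
  · have hpot := continuous_potential hGm hGbdd fun y hy => hGzero y fun h => hy (hR h)
    fun_prop
  · have hfP : (fun x => f x - Real.exp (Γ x) • (kernConst n)⁻¹ • potential G x) =
        fun x => Real.exp (Γ x) • w x := by
      funext x
      rw [hw_def, hu_def, smul_sub, smul_smul (Real.exp (Γ x)) (Real.exp (-Γ x)), ← Real.exp_add,
        add_neg_cancel, Real.exp_zero, one_smul]
    rw [hfP]
    have hreg : ∀ x ∈ V, ContDiffAt ℝ 1 (fun x => Real.exp (Γ x) • w x) x := fun x hx =>
      hΓ.exp.contDiffAt.smul (hw x hx).1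
    refine ⟨fun x hx => (hreg x hx).contDiffWithinAt, fun x hx => ?_⟩
    rw [diracGamma_eq Γ ((hreg x hx).differentiableAt one_ne_zero)]
    simp only [smul_smul, ← Real.exp_add, neg_add_cancel, Real.exp_zero, one_smul]
    rw [(hw x hx).2, smul_zero]
  · intro K x hx
    -- This bound is adapted to the point `x`: the outer factor `e^{Γ(x)}` turns it into `e^K M`.
    have hGx : ∀ y, ‖G y‖ ≤ Real.exp (K - Γ x) * M := by
      intro y
      by_cases hy : y ∈ V
      · refine (hGnorm y hy).trans ?_
        gcongr
        linarith [hx y hy]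
      · rw [hGzero y hy, norm_zero]; positivity
    have h := (hB G _ V hGm hGx hV.measurableSet hVfin hGzero x).2
    rw [norm_smul, norm_smul, Real.norm_of_nonneg (Real.exp_pos _).le,
      Real.norm_of_nonneg (inv_pos.2 hc).le]
    calc _ ≤ Real.exp (Γ x) * ((kernConst n)⁻¹ * (B * (Real.exp (K - Γ x) * M) *
          volume.real V ^ (1 / ((n : ℝ) + 1)))) := by gcongr
      _ = (kernConst n)⁻¹ * B * (Real.exp (Γ x) * Real.exp (K - Γ x)) *
          volume.real V ^ (1 / ((n : ℝ) + 1)) * M := by ring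
      _ = _ := by rw [← Real.exp_add, add_sub_cancel]

/-! ### Distance estimates in the supremum norm -/

theorem infDist_toC_le {n : ℕ} {Ω : TopologicalSpace.Compacts (Space n)} {f P : Space n → Cl n}
    (hf : ContinuousOn f Ω) (hP : Continuous P) {S : Set C(Ω, Cl n)}
    (hS : toC Ω (fun x => f x - P x) (hf.sub hP.continuousOn) ∈ S) {C : ℝ} (hC : 0 ≤ C)
    (hPC : ∀ x ∈ Ω, ‖P x‖ ≤ C) : Metric.infDist (toC Ω f hf) S ≤ C := by
  refine (Metric.infDist_le_dist_of_mem hS).trans ?_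
  rw [dist_eq_norm, ContinuousMap.norm_le _ hC]
  intro x
  have : (toC Ω f hf - toC Ω (fun x => f x - P x) (hf.sub hP.continuousOn)) x = P x :=
    sub_sub_cancel _ _
  rw [this]
  exact hPC x x.2

theorem infDist_gammaRegular_le {n : ℕ} {K β : ℝ} (hβ0 : 0 < β)
    (hβ : ∀ (Γ : Space n →L[ℝ] ℝ) (V : Set (Space n)) (f : Space n → Cl n) (M : ℝ),
      IsOpen V → Bornology.IsBounded V → ContDiffOn ℝ 1 f V → 0 ≤ M →
      (∀ y ∈ V, ‖diracGamma Γ f y‖ ≤ M) →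
      ∃ P : Space n → Cl n, Continuous P ∧ IsGammaRegularOn Γ (fun x => f x - P x) V ∧
        ∀ (K : ℝ) (x : Space n), (∀ y ∈ V, Γ x - Γ y ≤ K) →
          ‖P x‖ ≤ β * Real.exp K * volume.real V ^ (1 / ((n : ℝ) + 1)) * M)
    (Γ : Space n →L[ℝ] ℝ) (Ω : TopologicalSpace.Compacts (Space n))
    (hK : ∀ x ∈ Ω, ∀ y ∈ Ω, Γ x - Γ y ≤ K) {g h f : Space n → Cl n} (hg : ContinuousOn g Ω)
    (hf : IsSolution Γ Ω g h f) :
    Metric.infDist (toC Ω f hf.continuousOn) (gammaRegular Γ Ω) ≤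
      β * Real.exp (K + 1) * volume.real (Ω : Set (Space n)) ^ (1 / ((n : ℝ) + 1)) *
        ‖toC Ω g hg‖ := by
  have hgn : ∀ y (hy : y ∈ Ω), ‖g y‖ ≤ ‖toC Ω g hg‖ := fun y hy =>
    (toC Ω g hg).norm_coe_le_norm ⟨y, hy⟩
  obtain ⟨P, hPc, hPr, hPb⟩ := hβ Γ (interior Ω) f ‖toC Ω g hg‖ isOpen_interior
    (Ω.isCompact.isBounded.subset interior_subset) hf.contDiffOn (norm_nonneg _) fun y hy => by
      rw [hf.dirac_eq y hy]; exact hgn y (interior_subset hy)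
  refine infDist_toC_le hf.continuousOn hPc (S := gammaRegular Γ Ω) ⟨_, fun _ => rfl, hPr⟩
    (by positivity) fun x hx => ?_
  -- `K` would do here; `K + 1` gives the same constant as for solutions that are `C¹` up to the
  -- boundary.
  refine (hPb (K + 1) x fun y hy => by linarith [hK x hx y (interior_subset hy)]).trans ?_
  gcongr
  · exact Ω.isCompact.measure_lt_top.ne
  · exact interior_subset

/-- Outer regularity controls the volume and continuity of `D_γ f` its size. For `Γ`, each `y` in
`V` has some `z ∈ Ω` with `Γ z - Γ y < 1`, at the price of replacing `K` by `K + 1`. -/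
theorem exists_nhds_controlled {n : ℕ} {K : ℝ} (Γ : Space n →L[ℝ] ℝ)
    (Ω : TopologicalSpace.Compacts (Space n)) (hK : ∀ x ∈ Ω, ∀ y ∈ Ω, Γ x - Γ y ≤ K)
    {M δ : ℝ} (hδ : 0 < δ) {U : Set (Space n)} (hU : IsOpen U) (hΩU : (Ω : Set (Space n)) ⊆ U)
    {f : Space n → Cl n} (hf : ContDiffOn ℝ 1 f U) (hM : ∀ y ∈ Ω, ‖diracGamma Γ f y‖ ≤ M) :
    ∃ V : Set (Space n), IsOpen V ∧ (Ω : Set (Space n)) ⊆ V ∧ V ⊆ U ∧ Bornology.IsBounded V ∧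
      volume.real V ≤ volume.real (Ω : Set (Space n)) + δ ∧
      (∀ y ∈ V, ‖diracGamma Γ f y‖ ≤ M + δ) ∧ ∀ x ∈ Ω, ∀ y ∈ V, Γ x - Γ y ≤ K + 1 := by
  have hfin : volume (Ω : Set (Space n)) ≠ ⊤ := Ω.isCompact.measure_lt_top.ne
  obtain ⟨V₁, hΩV₁, hV₁, hvol⟩ := (Ω : Set (Space n)).exists_isOpen_lt_add hfin
    (ENNReal.ofReal_pos.2 hδ).ne'
  have hcont : ContinuousOn (diracGamma Γ f) U := by
    refine continuousOn_finsetSum _ fun j _ => (mulL n (e j)).continuous.comp_continuousOn ?_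
    refine ((hf.continuousOn_fderiv_of_isOpen hU le_rfl).clm_apply continuousOn_const).sub ?_
    simp only [pd, Γ.fderiv]
    exact ContinuousOn.const_smul (s := U) hf.continuousOn (Γ (EuclideanSpace.single j 1))
  have hV₂ : IsOpen (U ∩ (fun y => ‖diracGamma Γ f y‖) ⁻¹' Set.Iio (M + δ)) :=
    hcont.norm.isOpen_inter_preimage hU isOpen_Iio
  have hV₃ : IsOpen (⋃ z ∈ Ω, {y : Space n | Γ z - Γ y < 1}) :=
    isOpen_biUnion fun z _ => isOpen_lt (by fun_prop) continuous_const
  refine ⟨V₁ ∩ (U ∩ (fun y => ‖diracGamma Γ f y‖) ⁻¹' Set.Iio (M + δ)) ∩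
    (⋃ z ∈ Ω, {y : Space n | Γ z - Γ y < 1}) ∩ Metric.thickening 1 Ω,
    ((hV₁.inter hV₂).inter hV₃).inter Metric.isOpen_thickening, fun y hy => ?_,
    fun y hy => hy.1.1.2.1, Ω.isCompact.isBounded.thickening.subset Set.inter_subset_right,
    ?_, fun y hy => le_of_lt hy.1.1.2.2, fun x hx y hy => ?_⟩
  · exact ⟨⟨⟨hΩV₁ hy, hΩU hy, (hM y hy).trans_lt (by linarith)⟩,
      Set.mem_biUnion hy (by simp)⟩, Metric.self_subset_thickening one_pos _ hy⟩
  · refine ENNReal.toReal_le_of_le_ofReal (by positivity) ?_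
    rw [ENNReal.ofReal_add measureReal_nonneg hδ.le, ofReal_measureReal hfin]
    exact (measure_mono fun y hy => hy.1.1.1).trans hvol.le
  · obtain ⟨z, hz, hzy⟩ := Set.mem_iUnion₂.1 hy.1.2
    have hzy : Γ z - Γ y < 1 := hzy
    linarith [hK x hx z hz]

theorem infDist_gammaRegularNear_le {n : ℕ} {K β : ℝ} (hβ0 : 0 < β)
    (hβ : ∀ (Γ : Space n →L[ℝ] ℝ) (V : Set (Space n)) (f : Space n → Cl n) (M : ℝ),
      IsOpen V → Bornology.IsBounded V → ContDiffOn ℝ 1 f V → 0 ≤ M →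
      (∀ y ∈ V, ‖diracGamma Γ f y‖ ≤ M) →
      ∃ P : Space n → Cl n, Continuous P ∧ IsGammaRegularOn Γ (fun x => f x - P x) V ∧
        ∀ (K : ℝ) (x : Space n), (∀ y ∈ V, Γ x - Γ y ≤ K) →
          ‖P x‖ ≤ β * Real.exp K * volume.real V ^ (1 / ((n : ℝ) + 1)) * M)
    (Γ : Space n →L[ℝ] ℝ) (Ω : TopologicalSpace.Compacts (Space n))
    (hK : ∀ x ∈ Ω, ∀ y ∈ Ω, Γ x - Γ y ≤ K) {g h f : Space n → Cl n} (hg : ContinuousOn g Ω)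
    (hf : IsSolutionUpToBoundary Γ Ω g h f) :
    Metric.infDist (toC Ω f hf.continuousOn) (gammaRegularNear Γ Ω) ≤
      β * Real.exp (K + 1) * volume.real (Ω : Set (Space n)) ^ (1 / ((n : ℝ) + 1)) *
        ‖toC Ω g hg‖ := by
  have hgn : ∀ y (hy : y ∈ Ω), ‖g y‖ ≤ ‖toC Ω g hg‖ := fun y hy =>
    (toC Ω g hg).norm_coe_le_norm ⟨y, hy⟩
  obtain ⟨U, hU, hΩU, hfU⟩ := hf.contDiffOn
  have hle : ∀ δ : ℝ, 0 < δ → Metric.infDist (toC Ω f hf.continuousOn) (gammaRegularNear Γ Ω) ≤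
      β * Real.exp (K + 1) * (volume.real (Ω : Set (Space n)) + δ) ^ (1 / ((n : ℝ) + 1)) *
        (‖toC Ω g hg‖ + δ) := by
    intro δ hδ
    obtain ⟨V, hV, hΩV, hVU, hVb, hvol, hVM, hVK⟩ := exists_nhds_controlled Γ Ω hK hδ hU hΩU hfU
      (M := ‖toC Ω g hg‖) fun y hy => by rw [hf.dirac_eq y hy]; exact hgn y hy
    obtain ⟨P, hPc, hPr, hPb⟩ := hβ Γ V f (‖toC Ω g hg‖ + δ) hV hVb (hfU.mono hVU)
      (by positivity) hVM
    refine infDist_toC_le hf.continuousOn hPc (S := gammaRegularNear Γ Ω)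
      ⟨_, V, fun _ => rfl, hV, hΩV, hPr⟩ (by positivity) fun x hx => ?_
    refine (hPb (K + 1) x (hVK x hx)).trans ?_
    gcongr
  -- The neighbourhood and the approximant change with `δ`, but the distance does not, so `δ` may
  -- tend to zero.
  have hlim : Tendsto (fun δ : ℝ => β * Real.exp (K + 1) *
      (volume.real (Ω : Set (Space n)) + δ) ^ (1 / ((n : ℝ) + 1)) * (‖toC Ω g hg‖ + δ))
      (𝓝[>] 0) (𝓝 (β * Real.exp (K + 1) *
        (volume.real (Ω : Set (Space n)) + 0) ^ (1 / ((n : ℝ) + 1)) * (‖toC Ω g hg‖ + 0))) := by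
    have hn : (0 : ℝ) ≤ 1 / ((n : ℝ) + 1) := by positivity
    have : Continuous fun δ : ℝ => β * Real.exp (K + 1) *
        (volume.real (Ω : Set (Space n)) + δ) ^ (1 / ((n : ℝ) + 1)) * (‖toC Ω g hg‖ + δ) :=
      (continuous_const.mul ((continuous_const.add continuous_id).rpow_const
        fun _ => Or.inr hn)).mul (continuous_const.add continuous_id)
    exact (this.tendsto 0).mono_left nhdsWithin_le_nhds
  rw [add_zero, add_zero] at hlim
  exact ge_of_tendsto hlim (eventually_mem_of_tendsto_nhdsWithin tendsto_id |>.mono hle)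

end CliffordAnalysis

theorem mainTheorem4 (n : ℕ) (K : ℝ) :
    ∃ β : ℝ, 0 < β ∧
      ∀ (Γ : Space n →L[ℝ] ℝ) (Ω : TopologicalSpace.Compacts (Space n)),
        (∀ x ∈ Ω, ∀ y ∈ Ω, Γ x - Γ y ≤ K) →
        ∀ (g h f : Space n → Cl n) (hg : ContDiffOn ℝ ∞ g Ω)
          (_hh : ContDiffOn ℝ ∞ h (frontier (Ω : Set (Space n)))),
          (∀ hf : IsSolution Γ Ω g h f,
            Metric.infDist (toC Ω f hf.continuousOn) (gammaRegular Γ Ω) ≤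
              β * volume.real (Ω : Set (Space n)) ^ (1 / ((n : ℝ) + 1)) *
                ‖toC Ω g hg.continuousOn‖) ∧
          (∀ hf : IsSolutionUpToBoundary Γ Ω g h f,
            Metric.infDist (toC Ω f hf.continuousOn) (gammaRegularNear Γ Ω) ≤
              β * volume.real (Ω : Set (Space n)) ^ (1 / ((n : ℝ) + 1)) *
                ‖toC Ω g hg.continuousOn‖) := by
  obtain ⟨β, hβ0, hβ⟩ := exists_gammaRegular_correction n
  exact ⟨β * Real.exp (K + 1), by positivity, fun Γ Ω hK g h f hg _ =>
    ⟨infDist_gammaRegular_le hβ0 hβ Γ Ω hK hg.continuousOn,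
      infDist_gammaRegularNear_le hβ0 hβ Γ Ω hK hg.continuousOn⟩⟩
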